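/- Let $\mathsf M=\langle S,\bar s,A,E,\Delta\rangle$ be a Markov decision process: $S$ and $A$ are finite sets of states and actions, $\bar s\in S$ is the initial state, $E(s)\subseteq A$ is the non-empty set of actions enabled in $s$, with $E(s)\cap E(s')=\emptyset$ for $s\neq s'$, and $\Delta(s,a)$ is a probability distribution on $S$ for every $s\in S$ and $a\in E(s)$. Let $0,1\in S$ be designated terminal states (a state $s$ is terminal if $\Delta(s,a)(s)=1$ for all $a\in E(s)$). An end component (EC) of $\mathsf M$ is a pair $(R,B)$ with $\emptyset\ne R\subseteq S$ and $B\subseteq\bigcup_{s\in R}E(s)$ such that (1) if $s\in R$, $a\in B\cap E(s)$ and $\Delta(s,a)(s')>0$, then $s'\in R$; and (2) for all $s,s'\in R$ there is a finite path $s_0a_0s_1\cdots s_n$ of $\mathsf M$ with $s_0=s$, $s_n=s'$ and $a_k\in B$ for all $0\le k<n$. Let $U:S\times A\to\mathbb R$. The Explore phase (for $U$) generates a path $s_0a_0s_1a_1\cdots$ as follows: $s_0=\bar s$, and for $k=1,2,\dots$ the $k$-th iteration picks $a_{k-1}$ uniformly at random among the actions maximising $U(s_{k-1},\cdot)$ over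 $E(s_{k-1})$, samples $s_k$ according to $\Delta(s_{k-1},a_{k-1})$, and appends $a_{k-1}s_k$ to the path. The phase terminates after iteration $k$ if $s_k\in\{0,1\}$. Let $K$, $E_m$ and $p_{\min}$ be real numbers with $K\ge|S|$, $E_m\ge\max_{s\in S}|E(s)|$ and $0<p_{\min}\le\Delta(s,a)(s')$ for all $s\in S$, $a\in E(s)$ and $s'$ with $\Delta(s,a)(s')>0$. Put $$\kappa=K\cdot E_m+1,\qquad c=\exp\left(-\frac{(p_{\min}/E_m)^{\kappa}}{\kappa}\right),$$ and let $i\ge\kappa$ be an integer. Assume that the Explore phase terminates with probability less than $1$. Then the probability that it does not terminate within $3i^3$ iterations is positive. Moreover, let $S_i$ and $A_i$ be the sets of the states $s$ and of the actions $a$, respectively, of those state–action pairs $(s,a)$ that occur more than $i$ times on the path explored in the first $3i^3$ iterations. Conditionally on the Explore phase not terminating within $3i^3$ iterations, the probability that $(S_i,A_i)$ is an end component of $\mathsf M$ is at least $$1-2c^i i^3\left(\frac{p_{\min}}{E_m}\right)^{-\kappa}.$$ -/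

import Mathlib

open MeasureTheory ProbabilityTheory

/-- A Markov decision process with states `S` and actions `A` (both assumed finite wherever the
structure is used). `trans s a` is only meaningful when `a` is enabled in `s`. As usual, every
action is enabled in at most one state. -/
structure MDP (S : Type*) (A : Type*) where
  /-- the initial state -/
  init : S
  /-- the enabled actions of a state -/
  enabled : S → Finset A
  enabled_nonempty : ∀ s, (enabled s).Nonempty
  enabled_disjoint : ∀ s t, s ≠ t → Disjoint (enabled s) (enabled t)
  /-- the probabilistic transition function -/
  trans : S → A → PMF S

namespace MDP

variable {S A : Type*}

/-- A state is terminal if every enabled action leads back to it with probability one. -/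
def IsTerminal (M : MDP S A) (s : S) : Prop :=
  ∀ a ∈ M.enabled s, M.trans s a s = 1

/-- One step of a path of the MDP that uses an action from `B`. -/
def StepIn (M : MDP S A) (B : Set A) (s t : S) : Prop :=
  ∃ a ∈ B, a ∈ M.enabled s ∧ 0 < M.trans s a t

/-- `(R, B)` is an end component: a nonempty set `R` of states and a set `B` of actions enabled in
states of `R` such that the actions of `B` never leave `R`, and any two states of `R` are connected
by a finite path all of whose actions lie in `B`. -/
structure IsEndComponent (M : MDP S A) (R : Set S) (B : Set A) : Prop where
  nonempty : R.Nonempty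
  enabled : ∀ a ∈ B, ∃ s ∈ R, a ∈ M.enabled s
  closed : ∀ s ∈ R, ∀ a ∈ B, a ∈ M.enabled s → ∀ t, 0 < M.trans s a t → t ∈ R
  connected : ∀ s ∈ R, ∀ t ∈ R, Relation.ReflTransGen (M.StepIn B) s t

open Classical in
/-- The enabled actions of `s` that maximise `U s`. -/
noncomputable def maxActions (M : MDP S A) (U : S → A → ℝ) (s : S) : Finset A :=
  (M.enabled s).filter fun a => ∀ b ∈ M.enabled s, U s b ≤ U s a

theorem maxActions_nonempty (M : MDP S A) (U : S → A → ℝ) (s : S) :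
    (M.maxActions U s).Nonempty := by
  classical
  obtain ⟨a, ha, hmax⟩ := (M.enabled s).exists_max_image (U s) (M.enabled_nonempty s)
  exact ⟨a, by simpa [maxActions] using ⟨ha, hmax⟩⟩

/-- The memoryless strategy that picks, uniformly at random, an enabled action maximising `U`. -/
noncomputable def greedy (M : MDP S A) (U : S → A → ℝ) (s : S) : PMF A :=
  PMF.uniformOfFinset (M.maxActions U s) (M.maxActions_nonempty U s)

/-- The law of the state-action pair `(s, a)` when the state `s` is given and the action `a` is
picked by the Explore phase. -/
noncomputable def choose (M : MDP S A) (U : S → A → ℝ) (s : S) : PMF (S × A) :=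
  (M.greedy U s).map fun a => (s, a)

/-- The law of the next state-action pair of the Explore phase after the pair `x`: the next state is
sampled according to the transition function, then an action is picked in that state. -/
noncomputable def exploreStep (M : MDP S A) (U : S → A → ℝ) (x : S × A) : PMF (S × A) :=
  (M.trans x.1 x.2).bind (M.choose U)

section Measure

variable [Countable S] [Countable A] [MeasurableSpace S] [MeasurableSpace A]
  [DiscreteMeasurableSpace S] [DiscreteMeasurableSpace A]

/-- The one-step kernel of the Explore phase, as a kernel from the past up to time `n`. -/
noncomputable def exploreKernel (M : MDP S A) (U : S → A → ℝ) (n : ℕ) :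
    Kernel (Finset.Iic n → S × A) (S × A) :=
  (Kernel.ofFunOfCountable fun x : S × A => (M.exploreStep U x).toMeasure).comap
    (fun h => h ⟨n, Finset.mem_Iic.2 le_rfl⟩) (measurable_pi_apply _)

instance instIsMarkovKernelExploreKernel (M : MDP S A) (U : S → A → ℝ) (n : ℕ) :
    IsMarkovKernel (M.exploreKernel U n) := by
  refine ⟨fun h => ?_⟩
  rw [exploreKernel, Kernel.comap_apply]
  exact PMF.toMeasure.isProbabilityMeasure (M.exploreStep U (h ⟨n, _⟩))

/-- The law of the infinite path `s₀ a₀ s₁ a₁ ⋯` (recorded as `n ↦ (sₙ, aₙ)`) sampled from the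
initial state when actions are picked uniformly among those maximising `U`. The Explore phase
follows this path until it terminates. -/
noncomputable def exploreMeasure (M : MDP S A) (U : S → A → ℝ) : Measure (ℕ → S × A) :=
  ((M.choose U M.init).toMeasure.map fun x (_ : Finset.Iic 0) => x).bind
    (Kernel.traj (X := fun _ => S × A) (M.exploreKernel U) 0)

end Measure

end MDP

/-- Iteration `k` of the Explore phase appends `aₖ₋₁ sₖ` to the path; the phase stops as soon as the
state just appended is one of the two designated states. -/
def terminatesWithin {S A : Type*} (zero one : S) (n : ℕ) : Set (ℕ → S × A) :=
  {ω | ∃ k, 1 ≤ k ∧ k ≤ n ∧ ((ω k).1 = zero ∨ (ω k).1 = one)}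

/-- The Explore phase terminates after some number of iterations. -/
def terminates {S A : Type*} (zero one : S) : Set (ℕ → S × A) :=
  {ω | ∃ k, 1 ≤ k ∧ ((ω k).1 = zero ∨ (ω k).1 = one)}

open Classical in
/-- The number of occurrences of the state-action pair `x` on the finite path
`s₀ a₀ s₁ ⋯ aₙ₋₁ sₙ` explored in the first `n` iterations. -/
noncomputable def occurrences {S A : Type*} (ω : ℕ → S × A) (n : ℕ) (x : S × A) : ℕ :=
  ((Finset.range n).filter fun k => ω k = x).card

/-- States of the pairs occurring more than `i` times on the path of the first `n` iterations. -/
def appStates {S A : Type*} (ω : ℕ → S × A) (n i : ℕ) : Set S :=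
  {s | ∃ a, i < occurrences ω n (s, a)}

/-- Actions of the pairs occurring more than `i` times on the path of the first `n` iterations. -/
def appActions {S A : Type*} (ω : ℕ → S × A) (n i : ℕ) : Set A :=
  {a | ∃ s, i < occurrences ω n (s, a)}

/-!
The pairs `(s, a)` with `a` enabled in `s` form the state space of a Markov chain, with at most
`m ≤ K * Em` states and all positive transition probabilities at least `q = pmin / Em`. A target
that can be reached from everywhere is reached within `m` steps with probability at least `q ^ m`,
so it is avoided for `i` steps with probability at most `(1 - q ^ m) ^ (i / m)`.

Divide time into blocks of length `i`. Up to a failure event of this size the chain enters a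
recurrent class in the first block, and up to `(i + 1) * m` further such events it visits every pair
of that class in each of the next `i + 1` blocks. The pairs seen more than `i` times are then
exactly those of the class: a pair outside it can only occur in the first block. A recurrent class
projects to an end component.

Conditioning on nontermination divides the failure probability by the probability of not
terminating, which is at least `q ^ κ`: if the phase does not terminate almost surely, then some
pair occurring at time `1` leads within `m - 1` steps, without terminating, to a pair from which
termination is impossible.
-/

open Filter
open scoped ENNReal Topology

section Reachability

variable {X : Type*} {r : X → X → Prop} {T : Set X}

/-- A set that is never left along the relation `r`. -/
def ClosedUnder (r : X → X → Prop) (C : Set X) : Prop :=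
  ∀ x ∈ C, ∀ y, r x y → y ∈ C

/-- The points from which `T` can be reached in exactly `k` steps along `r`. -/
def reachIn (r : X → X → Prop) (T : Set X) : ℕ → Set X
  | 0 => T
  | k + 1 => {x | ∃ y, r x y ∧ y ∈ reachIn r T k}

/-- The distance to `T` along `r`; the junk value is `0` where `T` cannot be reached. -/
noncomputable def distTo (r : X → X → Prop) (T : Set X) (x : X) : ℕ :=
  sInf {k | x ∈ reachIn r T k}

theorem ClosedUnder.mem_of_reflTransGen {C : Set X} (hC : ClosedUnder r C) {x y : X}
    (hxy : Relation.ReflTransGen r x y) (hx : x ∈ C) : y ∈ C := by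
  induction hxy with
  | refl => exact hx
  | tail _ hstep ih => exact hC _ ih _ hstep

theorem exists_mem_reachIn_of_reflTransGen {x y : X} (hxy : Relation.ReflTransGen r x y)
    (hy : y ∈ T) : ∃ k, x ∈ reachIn r T k := by
  induction hxy using Relation.ReflTransGen.head_induction_on with
  | refl => exact ⟨0, hy⟩
  | head hstep _ ih =>
    obtain ⟨k, hk⟩ := ih
    exact ⟨k + 1, _, hstep, hk⟩

theorem exists_mem_distTo_eq {D : Set X} (hD : ClosedUnder r D) {k : ℕ} {x : X} (hx : x ∈ D)
    (hxk : x ∈ reachIn r T k) (hdist : distTo r T x = k) {l : ℕ} (hl : l ≤ k) :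
    ∃ y ∈ D, distTo r T y = l := by
  induction k generalizing x with
  | zero => exact ⟨x, hx, by omega⟩
  | succ k ih =>
    obtain rfl | hl := Nat.eq_or_lt_of_le hl
    · exact ⟨x, hx, hdist⟩
    obtain ⟨y, hxy, hyk⟩ := hxk
    have hy_le : distTo r T y ≤ k := Nat.sInf_le hyk
    have hx_le : distTo r T x ≤ distTo r T y + 1 :=
      Nat.sInf_le ⟨y, hxy, Nat.sInf_mem (s := {j | y ∈ reachIn r T j}) ⟨k, hyk⟩⟩
    exact ih (hD x hx y hxy) hyk (by omega) (by omega)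

theorem exists_lt_card_mem_reachIn {D : Finset X} (hD : ClosedUnder r D) {x y : X} (hx : x ∈ D)
    (hxy : Relation.ReflTransGen r x y) (hy : y ∈ T) : ∃ k < D.card, x ∈ reachIn r T k := by
  classical
  have hmem : x ∈ reachIn r T (distTo r T x) :=
    Nat.sInf_mem (exists_mem_reachIn_of_reflTransGen hxy hy)
  refine ⟨distTo r T x, ?_, hmem⟩
  have hsub : Finset.range (distTo r T x + 1) ⊆ D.image (distTo r T) := fun l hl =>
    Finset.mem_image.2 (exists_mem_distTo_eq hD hx hmem rfl (Finset.mem_range_succ_iff.1 hl))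
  calc distTo r T x < (Finset.range (distTo r T x + 1)).card := by simp
    _ ≤ D.card := (Finset.card_le_card hsub).trans Finset.card_image_le

end Reachability

section TransitionFunction

variable {X : Type*} {p : X → PMF X} {T : Set X} {q r : ℝ≥0∞}

/-- The transitions of positive probability of the transition function `p`. -/
def PosStep (p : X → PMF X) (x y : X) : Prop :=
  p x y ≠ 0

/-- Reachability by finitely many transitions of positive probability. -/
abbrev Reaches (p : X → PMF X) : X → X → Prop :=
  Relation.ReflTransGen (PosStep p)

/-- The transitions of a chain with transition function `p` that is stopped on hitting `T`. -/
def LiveStep (p : X → PMF X) (T : Set X) (x y : X) : Prop :=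
  x ∉ T ∧ PosStep p x y

/-- The states from which a chain with transition function `p` cannot reach `T`. -/
def safeStates (p : X → PMF X) (T : Set X) : Set X :=
  {x | ∀ y, Reaches p x y → y ∉ T}

theorem closedUnder_setOf_reaches (p : X → PMF X) (x : X) :
    ClosedUnder (PosStep p) {y | Reaches p x y} :=
  fun _ hxy _ hstep => hxy.tail hstep

theorem ClosedUnder.liveStep {C : Set X} (hC : ClosedUnder (PosStep p) C) (T : Set X) :
    ClosedUnder (LiveStep p T) C :=
  fun x hx y hxy => hC x hx y hxy.2

theorem Reaches.exists_reflTransGen_liveStep {x y : X} (hxy : Reaches p x y) (hy : y ∈ T) :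
    ∃ z ∈ T, Relation.ReflTransGen (LiveStep p T) x z := by
  induction hxy using Relation.ReflTransGen.head_induction_on with
  | refl => exact ⟨y, hy, .refl⟩
  | @head x x' hstep _ ih =>
    by_cases hx : x ∈ T
    · exact ⟨x, hx, .refl⟩
    · obtain ⟨z, hz, hxz⟩ := ih
      exact ⟨z, hz, hxz.head ⟨hx, hstep⟩⟩

/-- The probability that a chain with transition function `p`, started in a given state, avoids `T`
at the times `0, …, k - 1`. -/
noncomputable def avoidProb (p : X → PMF X) (T : Set X) : ℕ → X → ℝ≥0∞
  | 0 => 1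
  | k + 1 => Tᶜ.indicator fun x => ∑' y, p x y * avoidProb p T k y

theorem avoidProb_zero (x : X) : avoidProb p T 0 x = 1 := rfl

theorem avoidProb_succ_of_mem {x : X} (hx : x ∈ T) (k : ℕ) : avoidProb p T (k + 1) x = 0 :=
  Set.indicator_of_notMem (Set.notMem_compl_iff.2 hx) _

theorem avoidProb_succ_of_notMem {x : X} (hx : x ∉ T) (k : ℕ) :
    avoidProb p T (k + 1) x = ∑' y, p x y * avoidProb p T k y :=
  Set.indicator_of_mem (Set.mem_compl hx) _

theorem avoidProb_succ_le (k : ℕ) (x : X) :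
    avoidProb p T (k + 1) x ≤ ∑' y, p x y * avoidProb p T k y :=
  Set.indicator_le_self _ _ x

theorem antitone_avoidProb (p : X → PMF X) (T : Set X) : Antitone (avoidProb p T) := by
  refine antitone_nat_of_succ_le fun k => ?_
  induction k with
  | zero =>
    intro x
    refine (avoidProb_succ_le 0 x).trans_eq ?_
    simp only [avoidProb_zero, mul_one, PMF.tsum_coe]
  | succ k ih =>
    refine fun x => Set.indicator_le_indicator ?_
    gcongr with y
    exact ih y

theorem avoidProb_le_one (k : ℕ) (x : X) : avoidProb p T k x ≤ 1 :=
  antitone_avoidProb p T k.zero_le x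

theorem avoidProb_add_le_mul {D : Set X} (hD : ClosedUnder (LiveStep p T) D) {b : ℕ}
    (hb : ∀ x ∈ D, avoidProb p T b x ≤ r) (a : ℕ) {x : X} (hx : x ∈ D) :
    avoidProb p T (a + b) x ≤ avoidProb p T a x * r := by
  induction a generalizing x with
  | zero => simpa only [zero_add, avoidProb_zero, one_mul] using hb x hx
  | succ a ih =>
    rw [Nat.add_right_comm]
    by_cases hxT : x ∈ T
    · simp only [avoidProb_succ_of_mem hxT, zero_le]
    rw [avoidProb_succ_of_notMem hxT, avoidProb_succ_of_notMem hxT, ← ENNReal.tsum_mul_right]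
    refine ENNReal.tsum_le_tsum fun y => ?_
    by_cases hxy : p x y = 0
    · simp only [hxy, zero_mul, le_refl]
    · rw [mul_assoc]
      gcongr
      exact ih (hD x hx y ⟨hxT, hxy⟩)

theorem avoidProb_mul_le_pow {D : Set X} (hD : ClosedUnder (LiveStep p T) D) {m : ℕ}
    (hm : ∀ x ∈ D, avoidProb p T m x ≤ r) (n : ℕ) {x : X} (hx : x ∈ D) :
    avoidProb p T (m * n) x ≤ r ^ n := by
  induction n generalizing x with
  | zero => simp only [mul_zero, pow_zero, avoidProb_zero, le_refl]
  | succ n ih =>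
    rw [mul_add_one, add_comm, pow_succ']
    exact (avoidProb_add_le_mul hD (fun y hy => ih hy) m hx).trans (by gcongr; exact hm x hx)

theorem avoidProb_add_pow_le_one {D : Set X} (hD : ClosedUnder (LiveStep p T) D)
    (hq : ∀ x ∈ D, ∀ y, PosStep p x y → q ≤ p x y) {k : ℕ} {x : X} (hx : x ∈ D)
    (hxk : x ∈ reachIn (LiveStep p T) T k) : avoidProb p T (k + 1) x + q ^ k ≤ 1 := by
  classical
  induction k generalizing x with
  | zero => rw [pow_zero, avoidProb_succ_of_mem (show x ∈ T from hxk), zero_add]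
  | succ k ih =>
    obtain ⟨y, hxy, hyk⟩ := hxk
    calc avoidProb p T (k + 1 + 1) x + q ^ (k + 1)
        ≤ ∑' z, p x z * avoidProb p T (k + 1) z + p x y * q ^ k := by
          rw [pow_succ']
          gcongr
          · exact avoidProb_succ_le _ _
          · exact hq x hx y hxy.2
      _ = ∑' z, p x z * (avoidProb p T (k + 1) z + if z = y then q ^ k else 0) := by
          simp only [mul_add, ENNReal.tsum_add, mul_ite, mul_zero, tsum_ite_eq]
      _ ≤ ∑' z, p x z * 1 := by
          gcongr with z
          split_ifs with hzy
          · subst hzy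
            exact ih (hD x hx z hxy) hyk
          · simpa only [add_zero] using avoidProb_le_one _ _
      _ = 1 := by simp only [mul_one, PMF.tsum_coe]

theorem avoidProb_le_one_sub_pow_pow {D : Finset X} (hD : ClosedUnder (LiveStep p T) D) {m : ℕ}
    (hm : D.card ≤ m) (hq1 : q ≤ 1) (hq : ∀ x ∈ D, ∀ y, PosStep p x y → q ≤ p x y)
    (hT : ∀ x ∈ D, ∃ y ∈ T, Reaches p x y) (i : ℕ) {x : X} (hx : x ∈ D) :
    avoidProb p T i x ≤ (1 - q ^ m) ^ (i / m) := by
  have hblock : ∀ x ∈ (D : Set X), avoidProb p T m x ≤ 1 - q ^ m := by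
    intro x hx
    obtain ⟨y, hyT, hxy⟩ := hT x hx
    obtain ⟨z, hzT, hxz⟩ := hxy.exists_reflTransGen_liveStep hyT
    obtain ⟨k, hk, hxk⟩ := exists_lt_card_mem_reachIn hD hx hxz hzT
    refine ENNReal.le_sub_of_add_le_right (ENNReal.pow_ne_top (hq1.trans_lt ENNReal.one_lt_top).ne)
      (le_trans ?_ (avoidProb_add_pow_le_one hD hq hx hxk))
    exact add_le_add (antitone_avoidProb p T (by omega) x)
      (pow_le_pow_right_of_le_one' hq1 (by omega))
  exact (antitone_avoidProb p T (Nat.mul_div_le i m) x).trans (avoidProb_mul_le_pow hD hblock _ hx)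

theorem avoidProb_eq_one_of_mem_safeStates (k : ℕ) {x : X} (hx : x ∈ safeStates p T) :
    avoidProb p T k x = 1 := by
  induction k generalizing x with
  | zero => rfl
  | succ k ih =>
    rw [avoidProb_succ_of_notMem (hx x .refl), ← (p x).tsum_coe]
    refine tsum_congr fun y => ?_
    by_cases hxy : p x y = 0
    · rw [hxy, zero_mul]
    · rw [ih fun z hyz => hx z (hyz.head hxy), mul_one]

theorem pow_le_avoidProb {D : Set X} (hD : ClosedUnder (LiveStep p T) D) (hq1 : q ≤ 1)
    (hq : ∀ x ∈ D, ∀ y, PosStep p x y → q ≤ p x y) {k : ℕ} {x : X} (hx : x ∈ D)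
    (hxk : x ∈ reachIn (LiveStep p T) (safeStates p T) k) (j : ℕ) :
    q ^ k ≤ avoidProb p T j x := by
  induction k generalizing x j with
  | zero => rw [avoidProb_eq_one_of_mem_safeStates j hxk, pow_zero]
  | succ k ih =>
    obtain ⟨y, hxy, hyk⟩ := hxk
    cases j with
    | zero => exact pow_le_one' hq1 _
    | succ j =>
      rw [avoidProb_succ_of_notMem hxy.1, pow_succ']
      calc q * q ^ k ≤ p x y * avoidProb p T j y :=
            mul_le_mul' (hq x hx y hxy.2) (ih (hD x hx y hxy) hyk j)
        _ ≤ ∑' z, p x z * avoidProb p T j z := ENNReal.le_tsum y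

theorem tendsto_avoidProb_or_forall_pow_le {D : Finset X} (hD : ClosedUnder (LiveStep p T) D)
    {m : ℕ} (hm : D.card ≤ m + 1) (hq0 : q ≠ 0) (hq1 : q ≤ 1)
    (hq : ∀ x ∈ D, ∀ y, PosStep p x y → q ≤ p x y) {x : X} (hx : x ∈ D) :
    Tendsto (avoidProb p T · x) atTop (𝓝 0) ∨ ∀ k, q ^ m ≤ avoidProb p T k x := by
  classical
  by_cases hsafe : ∃ y ∈ safeStates p T, Relation.ReflTransGen (LiveStep p T) x y
  · obtain ⟨y, hy, hxy⟩ := hsafe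
    obtain ⟨k, hk, hxk⟩ := exists_lt_card_mem_reachIn hD hx hxy hy
    exact .inr fun j => (pow_le_pow_right_of_le_one' hq1 (by omega)).trans
      (pow_le_avoidProb hD hq1 hq hx hxk j)
  · left
    let C : Finset X := D.filter (Relation.ReflTransGen (LiveStep p T) x)
    have hC : ClosedUnder (LiveStep p T) C := by
      intro y hy z hyz
      obtain ⟨hyD, hxy⟩ := Finset.mem_filter.1 hy
      exact Finset.mem_coe.2 (Finset.mem_filter.2 ⟨hD y hyD z hyz, hxy.tail hyz⟩)
    have hCT : ∀ y ∈ C, ∃ z ∈ T, Reaches p y z := by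
      intro y hy
      by_contra! hyT
      exact hsafe ⟨y, fun z hyz hz => hyT z hz hyz, (Finset.mem_filter.1 hy).2⟩
    have hlt : 1 - q ^ (m + 1) < 1 :=
      ENNReal.sub_lt_self ENNReal.one_ne_top one_ne_zero (pow_ne_zero _ hq0)
    refine tendsto_of_tendsto_of_tendsto_of_le_of_le tendsto_const_nhds
      ((ENNReal.tendsto_pow_atTop_nhds_zero_of_lt_one hlt).comp
        (Nat.tendsto_div_const_atTop m.succ_ne_zero)) (fun _ => zero_le) fun i => ?_
    exact avoidProb_le_one_sub_pow_pow hC ((Finset.card_filter_le _ _).trans hm) hq1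
      (fun y hy => hq y (Finset.mem_filter.1 hy).1) hCT i (Finset.mem_filter.2 ⟨hx, .refl⟩)

end TransitionFunction

section MarkovLaw

variable {X : Type*}

/-- The law `P` of a path in `X` has the Markov property with transition function `p`. The events
that are determined by the path up to time `n` are those whose membership depends only on the
coordinates in `Set.Iic n`. -/
def IsMarkovLaw [MeasurableSpace X] (p : X → PMF X) (P : Measure (ℕ → X)) : Prop :=
  ∀ (n : ℕ) (F : Set (ℕ → X)) (x y : X), DependsOn (· ∈ F) (Set.Iic n) →
    P (F ∩ {ω | ω n = x ∧ ω (n + 1) = y}) = P (F ∩ {ω | ω n = x}) * p x y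

theorem exists_frestrictLe_preimage_eq {n : ℕ} {F : Set (ℕ → X)}
    (hF : DependsOn (· ∈ F) (Set.Iic n)) :
    ∃ G : Set (Finset.Iic n → X), Preorder.frestrictLe (π := fun _ => X) n ⁻¹' G = F := by
  rw [← Finset.coe_Iic, dependsOn_iff_exists_comp] at hF
  obtain ⟨g, hg⟩ := hF
  exact ⟨{h | g h}, Set.ext fun ω => (iff_of_eq (congrFun hg ω)).symm⟩

theorem dependsOn_mem_univ (s : Set ℕ) : DependsOn (· ∈ (Set.univ : Set (ℕ → X))) s :=
  fun _ _ _ => rfl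

theorem dependsOn_inter_eval_eq {n : ℕ} {F : Set (ℕ → X)} (hF : DependsOn (· ∈ F) (Set.Iic n))
    (x : X) : DependsOn (· ∈ F ∩ {ω | ω n = x}) (Set.Iic (n + 1)) := by
  intro ω ω' h
  have hFω : (ω ∈ F) = (ω' ∈ F) := hF fun j hj => h j (Nat.le_succ_of_le hj)
  simp only [Set.mem_inter_iff, hFω, Set.mem_ofPred_eq, h n n.le_succ]

theorem IsMarkovLaw.measure_eval_eq_and_eval_succ_eq [MeasurableSpace X] {p : X → PMF X}
    {P : Measure (ℕ → X)} (hP : IsMarkovLaw p P) (n : ℕ) (x y : X) :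
    P {ω | ω n = x ∧ ω (n + 1) = y} = P {ω | ω n = x} * p x y := by
  simpa only [Set.univ_inter] using hP n Set.univ x y (dependsOn_mem_univ _)

variable [Countable X] [MeasurableSpace X]

theorem ae_measure_eval_eq_ne_zero (P : Measure (ℕ → X)) :
    ∀ᵐ ω ∂P, ∀ n, P {ω' | ω' n = ω n} ≠ 0 := by
  have hatom : ∀ᵐ ω ∂P, ∀ n x, P {ω' | ω' n = x} = 0 → ω n ≠ x := by
    simp only [ae_all_iff]
    exact fun n x hx => measure_eq_zero_iff_ae_notMem.1 hx
  filter_upwards [hatom] with ω hω n hn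
  exact hω n _ hn rfl

theorem IsMarkovLaw.ae_posStep {p : X → PMF X} {P : Measure (ℕ → X)} (hP : IsMarkovLaw p P) :
    ∀ᵐ ω ∂P, ∀ n, PosStep p (ω n) (ω (n + 1)) := by
  have hnull : ∀ᵐ ω ∂P, ∀ n x y, p x y = 0 → ¬ (ω n = x ∧ ω (n + 1) = y) := by
    simp only [ae_all_iff]
    intro n x y hxy
    have hstep := hP.measure_eval_eq_and_eval_succ_eq n x y
    rw [hxy, mul_zero] at hstep
    exact measure_eq_zero_iff_ae_notMem.1 hstep
  filter_upwards [hnull] with ω hω n hn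
  exact hω n _ _ hn ⟨rfl, rfl⟩

variable [DiscreteMeasurableSpace X]

theorem measurableSet_of_dependsOn_Iic {n : ℕ} {F : Set (ℕ → X)}
    (hF : DependsOn (· ∈ F) (Set.Iic n)) : MeasurableSet F := by
  obtain ⟨G, rfl⟩ := exists_frestrictLe_preimage_eq hF
  exact Preorder.measurable_frestrictLe n (MeasurableSet.of_discrete)

theorem isMarkovLaw_trajMeasure {p : X → PMF X} {μ₀ : Measure X} [IsProbabilityMeasure μ₀]
    {κ : (n : ℕ) → Kernel (Finset.Iic n → X) X} [∀ n, IsMarkovKernel (κ n)]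
    (hκ : ∀ n h, κ n h = (p (h ⟨n, Finset.mem_Iic.2 le_rfl⟩)).toMeasure) :
    IsMarkovLaw p (Kernel.trajMeasure (X := fun _ => X) μ₀ κ) := by
  intro n F x y hF
  obtain ⟨G, rfl⟩ := exists_frestrictLe_preimage_eq hF
  let G' : Set (Finset.Iic n → X) := G ∩ {h | h ⟨n, Finset.mem_Iic.2 le_rfl⟩ = x}
  have hκG' : ∀ h ∈ G', κ n h {y} = p x y := by
    rintro h ⟨-, rfl⟩
    rw [hκ, PMF.toMeasure_apply_singleton _ _ .of_discrete]
  have hlaw := congrArg (fun μ => μ (G' ×ˢ {y}))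
    (Kernel.map_frestrictLe_trajMeasure_compProd_eq_map_trajMeasure (X := fun _ => X)
      (μ₀ := μ₀) (κ := κ) (a := n))
  rw [Measure.map_apply (by fun_prop) (.prod .of_discrete .of_discrete),
    Measure.compProd_apply_prod .of_discrete .of_discrete,
    setLIntegral_congr_fun .of_discrete hκG', setLIntegral_const,
    Measure.map_apply (by fun_prop) .of_discrete, mul_comm] at hlaw
  refine Eq.trans ?_ hlaw.symm
  congr 1
  ext ω
  simp only [G', Set.mem_inter_iff, Set.mem_preimage, Set.mem_prod, Set.mem_ofPred_eq,
    Set.mem_singleton_iff, and_assoc]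
  rfl

variable {p : X → PMF X} {P : Measure (ℕ → X)} {T : Set X} {q r : ℝ≥0∞}

theorem tsum_measure_inter_eval_eq (F : Set (ℕ → X)) (n : ℕ) :
    ∑' x, P (F ∩ {ω | ω n = x}) = P F := by
  have hmeas (x : X) : MeasurableSet {ω : ℕ → X | ω n = x} :=
    measurable_pi_apply (X := fun _ => X) n (MeasurableSet.of_discrete (s := {x}))
  have hdisj : Pairwise (Function.onFun Disjoint fun x => {ω : ℕ → X | ω n = x}) :=
    fun x y hxy => Set.disjoint_left.2 fun ω hx hy => hxy (Eq.trans (Eq.symm hx) hy)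
  have hcover : ⋃ x, {ω : ℕ → X | ω n = x} = Set.univ :=
    Set.iUnion_eq_univ_iff.2 fun ω => ⟨ω n, rfl⟩
  simp only [Set.inter_comm F, ← Measure.restrict_apply (hmeas _)]
  rw [← measure_iUnion hdisj hmeas, hcover, Measure.restrict_apply_univ]

theorem IsMarkovLaw.measure_inter_avoid (hP : IsMarkovLaw p P) {n : ℕ} {F : Set (ℕ → X)}
    (hF : DependsOn (· ∈ F) (Set.Iic n)) (x : X) (k : ℕ) :
    P (F ∩ {ω | ω n = x ∧ ∀ j < k, ω (n + j) ∉ T}) =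
      P (F ∩ {ω | ω n = x}) * avoidProb p T k x := by
  induction k generalizing n F x with
  | zero =>
    simp only [Nat.not_lt_zero, false_imp_iff, implies_true, and_true, avoidProb_zero, mul_one]
  | succ k ih =>
    by_cases hx : x ∈ T
    · rw [avoidProb_succ_of_mem hx, mul_zero, ← measure_empty (μ := P)]
      congr 1
      refine Set.eq_empty_of_forall_notMem fun ω hω => hω.2.2 0 k.succ_pos ?_
      rwa [add_zero, hω.2.1]
    have hsplit (y : X) : F ∩ {ω | ω n = x ∧ ∀ j < k + 1, ω (n + j) ∉ T} ∩ {ω | ω (n + 1) = y} =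
        F ∩ {ω | ω n = x} ∩ {ω | ω (n + 1) = y ∧ ∀ j < k, ω (n + 1 + j) ∉ T} := by
      ext ω
      simp only [Set.mem_inter_iff, Set.mem_ofPred_eq, Nat.forall_lt_succ_left', add_zero,
        add_right_comm n 1, ← add_assoc]
      constructor
      · rintro ⟨⟨hω, hn, -, hav⟩, hy⟩
        exact ⟨⟨hω, hn⟩, hy, hav⟩
      · rintro ⟨⟨hω, hn⟩, hy, hav⟩
        exact ⟨⟨hω, hn, hn ▸ hx, hav⟩, hy⟩
    rw [avoidProb_succ_of_notMem hx, ← tsum_measure_inter_eval_eq _ (n + 1),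
      ← ENNReal.tsum_mul_left]
    refine tsum_congr fun y => ?_
    rw [hsplit, ih (dependsOn_inter_eval_eq hF x), Set.inter_assoc, ← Set.ofPred_and,
      hP n F x y hF, mul_assoc]

theorem IsMarkovLaw.measure_eval_eq_and_avoid (hP : IsMarkovLaw p P) (n : ℕ) (x : X) (k : ℕ) :
    P {ω | ω n = x ∧ ∀ j < k, ω (n + j) ∉ T} = P {ω | ω n = x} * avoidProb p T k x := by
  simpa only [Set.univ_inter] using
    hP.measure_inter_avoid (T := T) (dependsOn_mem_univ (Set.Iic n)) x k

theorem IsMarkovLaw.measure_mem_and_avoid_le [IsProbabilityMeasure P] (hP : IsMarkovLaw p P)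
    {D : Set X} {k : ℕ} (hr : ∀ x ∈ D, avoidProb p T k x ≤ r) (n : ℕ) :
    P {ω | ω n ∈ D ∧ ∀ j < k, ω (n + j) ∉ T} ≤ r := by
  have hatom (x : X) : P ({ω | ω n ∈ D ∧ ∀ j < k, ω (n + j) ∉ T} ∩ {ω | ω n = x}) ≤
      P (Set.univ ∩ {ω | ω n = x}) * r := by
    by_cases hx : x ∈ D
    · calc P ({ω | ω n ∈ D ∧ ∀ j < k, ω (n + j) ∉ T} ∩ {ω | ω n = x})
          ≤ P {ω | ω n = x ∧ ∀ j < k, ω (n + j) ∉ T} :=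
            measure_mono fun ω hω => ⟨hω.2, hω.1.2⟩
        _ ≤ P (Set.univ ∩ {ω | ω n = x}) * r := by
            rw [hP.measure_eval_eq_and_avoid, Set.univ_inter]
            gcongr
            exact hr x hx
    · refine (measure_mono_null (fun ω hω => hx ?_) measure_empty).trans_le zero_le
      exact Set.mem_ofPred_eq ▸ hω.2 ▸ hω.1.1
  calc P {ω | ω n ∈ D ∧ ∀ j < k, ω (n + j) ∉ T}
      ≤ ∑' x, P (Set.univ ∩ {ω | ω n = x}) * r := by
        rw [← tsum_measure_inter_eval_eq _ n]
        exact ENNReal.tsum_le_tsum hatom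
    _ = r := by rw [ENNReal.tsum_mul_right, tsum_measure_inter_eval_eq, measure_univ, one_mul]

theorem IsMarkovLaw.pow_le_measure_eval_eq (hP : IsMarkovLaw p P) {E : Set X}
    (hE : ClosedUnder (PosStep p) E) (hq : ∀ x ∈ E, ∀ y, PosStep p x y → q ≤ p x y)
    (h0 : ∀ x, P {ω | ω 0 = x} ≠ 0 → x ∈ E ∧ q ≤ P {ω | ω 0 = x}) (n : ℕ) {x : X}
    (hx : P {ω | ω n = x} ≠ 0) : x ∈ E ∧ q ^ (n + 1) ≤ P {ω | ω n = x} := by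
  induction n generalizing x with
  | zero => simpa only [zero_add, pow_one] using h0 x hx
  | succ n ih =>
    have hsum : P {ω | ω (n + 1) = x} = ∑' y, P {ω | ω n = y} * p y x := by
      rw [← tsum_measure_inter_eval_eq _ n]
      refine tsum_congr fun y => ?_
      rw [← hP.measure_eval_eq_and_eval_succ_eq, Set.ofPred_and, Set.inter_comm]
    rw [hsum, Ne, ENNReal.tsum_eq_zero, not_forall] at hx
    obtain ⟨y, hy⟩ := hx
    obtain ⟨hy0, hyx⟩ := mul_ne_zero_iff.1 hy
    obtain ⟨hyE, hqy⟩ := ih hy0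
    refine ⟨hE y hyE x hyx, ?_⟩
    calc q ^ (n + 1 + 1) ≤ P {ω | ω n = y} * p y x := by
          rw [pow_succ]
          exact mul_le_mul' hqy (hq y hyE x hyx)
      _ ≤ P {ω | ω (n + 1) = x} := by
          rw [hsum]
          exact ENNReal.le_tsum y

end MarkovLaw

section Recurrence

variable {X : Type*} {p : X → PMF X}

/-- A state to which the chain with transition function `p` can return from wherever it goes. -/
def IsRecurrent (p : X → PMF X) (x : X) : Prop :=
  ∀ y, Reaches p x y → Reaches p y x

/-- A closed communicating class of the chain with transition function `p`. -/
structure IsRecurrentClass (p : X → PMF X) (C : Set X) : Prop where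
  nonempty : C.Nonempty
  closed : ClosedUnder (PosStep p) C
  connected : ∀ x ∈ C, ∀ y ∈ C, Reaches p x y

theorem IsRecurrent.of_reaches {x y : X} (hx : IsRecurrent p x) (hxy : Reaches p x y) :
    IsRecurrent p y :=
  fun z hyz => (hx z (hxy.trans hyz)).trans hxy

theorem IsRecurrent.isRecurrentClass {x : X} (hx : IsRecurrent p x) :
    IsRecurrentClass p {y | Reaches p x y} where
  nonempty := ⟨x, .refl⟩
  closed := closedUnder_setOf_reaches p x
  connected y hy _ hz := (hx y hy).trans hz

theorem IsRecurrentClass.exists_posStep {C : Set X} (hC : IsRecurrentClass p C) {y : X}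
    (hy : y ∈ C) : ∃ x ∈ C, PosStep p x y := by
  obtain ⟨z, hz⟩ := (p y).support_nonempty
  have hyz : PosStep p y z := (p y).mem_support_iff z |>.1 hz
  have hzC : z ∈ C := hC.closed y hy z hyz
  obtain rfl | ⟨x, hzx, hxy⟩ := (hC.connected z hzC y hy).cases_tail
  · exact ⟨y, hy, hyz⟩
  · exact ⟨x, hC.closed.mem_of_reflTransGen hzx hzC, hxy⟩

theorem exists_isRecurrent_reaches {E : Set X} (hE : ClosedUnder (PosStep p) E) (hfin : E.Finite)
    {x : X} (hx : x ∈ E) : ∃ y, IsRecurrent p y ∧ Reaches p x y := by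
  have hsub {y : X} (hy : y ∈ E) : {z | Reaches p y z} ⊆ E :=
    fun z hyz => hE.mem_of_reflTransGen hyz hy
  obtain ⟨y, hxy, hmin⟩ := Set.exists_min_image {y | Reaches p x y}
    (fun y => {z | Reaches p y z}.ncard) (hfin.subset (hsub hx)) ⟨x, .refl⟩
  refine ⟨y, fun z hyz => ?_, hxy⟩
  have heq : {w | Reaches p z w} = {w | Reaches p y w} :=
    Set.eq_of_subset_of_ncard_le (fun w hzw => hyz.trans hzw) (hmin z (hxy.trans hyz))
      (hfin.subset (hsub (hsub hx hxy)))
  exact heq.symm.subset (Relation.ReflTransGen.refl : Reaches p y y)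

theorem reaches_of_posStep {ω : ℕ → X} (hω : ∀ n, PosStep p (ω n) (ω (n + 1))) {a b : ℕ}
    (hab : a ≤ b) : Reaches p (ω a) (ω b) := by
  induction b, hab using Nat.le_induction with
  | base => exact .refl
  | succ n _ ih => exact ih.tail (hω n)

theorem le_count_of_forall_exists_block {Q : ℕ → Prop} [DecidablePred Q] {a i l : ℕ}
    (hQ : ∀ b < l, ∃ j < i, Q (a + b * i + j)) : l ≤ Nat.count Q (a + l * i) := by
  induction l with
  | zero => exact Nat.zero_le _
  | succ l ih =>
    have hpos : Nat.count (fun j => Q (a + l * i + j)) i ≠ 0 :=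
      Nat.count_ne_iff_exists.2 (hQ l l.lt_succ_self)
    have hle := ih fun b hb => hQ b (Nat.lt_succ_of_lt hb)
    rw [Nat.succ_mul, ← add_assoc, Nat.count_add]
    omega

open Classical in
/-- The states that a path visits more than `i` times before time `N`. -/
def frequentStates (ω : ℕ → X) (i N : ℕ) : Set X :=
  {y | i < Nat.count (ω · = y) N}

theorem isRecurrentClass_frequentStates {ω : ℕ → X} (hω : ∀ n, PosStep p (ω n) (ω (n + 1)))
    {i N k : ℕ} (hN : (i + 2) * i ≤ N) (hk : k < i) (hrec : IsRecurrent p (ω k))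
    (hvisit : ∀ b < i + 1, ∀ y, Reaches p (ω k) y → ∃ j < i, ω (i + b * i + j) = y) :
    IsRecurrentClass p (frequentStates ω i N) := by
  classical
  have heq : frequentStates ω i N = {y | Reaches p (ω k) y} := by
    ext y
    simp only [frequentStates, Set.mem_ofPred_eq]
    constructor
    · intro hy
      obtain ⟨n, hn, rfl⟩ := Nat.exists_of_count_lt_count (a := i) ((Nat.count_le _).trans_lt hy)
      exact reaches_of_posStep hω (hk.le.trans hn.1)
    · intro hy
      calc i < Nat.count (ω · = y) (i + (i + 1) * i) :=
            le_count_of_forall_exists_block (Q := (ω · = y)) fun b hb => hvisit b hb y hy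
        _ ≤ Nat.count (ω · = y) N := Nat.count_monotone _ (by linarith)
  exact heq ▸ hrec.isRecurrentClass

theorem exists_missed_block {ω : ℕ → X} (hω : ∀ n, PosStep p (ω n) (ω (n + 1))) {i N : ℕ}
    (hN : (i + 2) * i ≤ N) (hnot : ¬ IsRecurrentClass p (frequentStates ω i N)) :
    (∀ j < i, ¬ IsRecurrent p (ω j)) ∨ ∃ b < i + 1, ∃ y, IsRecurrent p y ∧ Reaches p (ω 0) y ∧
      Reaches p y (ω (i + b * i)) ∧ ∀ j < i, ω (i + b * i + j) ≠ y := by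
  by_contra! hgood
  obtain ⟨⟨k, hk, hrec⟩, hvisit⟩ := hgood
  refine hnot (isRecurrentClass_frequentStates hω hN hk hrec fun b hb y hy => ?_)
  refine hvisit b hb y (hrec.of_reaches hy) ((reaches_of_posStep hω k.zero_le).trans hy) ?_
  exact (hrec y hy).trans (reaches_of_posStep hω (by omega))

variable [Countable X] [MeasurableSpace X] [DiscreteMeasurableSpace X] {P : Measure (ℕ → X)}
  [IsProbabilityMeasure P] {E : Finset X} {m : ℕ} {q : ℝ≥0∞} {T : Set X}

theorem IsMarkovLaw.measure_not_isRecurrent_le (hP : IsMarkovLaw p P)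
    (hE : ClosedUnder (PosStep p) E) (hm : E.card ≤ m) (hq1 : q ≤ 1)
    (hq : ∀ x ∈ E, ∀ y, PosStep p x y → q ≤ p x y) (i n : ℕ) :
    P {ω | ω n ∈ E ∧ ∀ j < i, ¬ IsRecurrent p (ω (n + j))} ≤ (1 - q ^ m) ^ (i / m) := by
  refine hP.measure_mem_and_avoid_le (D := E) (T := {x | IsRecurrent p x}) (fun x hx => ?_) n
  exact avoidProb_le_one_sub_pow_pow (hE.liveStep _) hm hq1 hq
    (fun x hx => exists_isRecurrent_reaches hE E.finite_toSet hx) i hx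

theorem IsMarkovLaw.measure_reaches_and_ne_le (hP : IsMarkovLaw p P)
    (hE : ClosedUnder (PosStep p) E) (hm : E.card ≤ m) (hq1 : q ≤ 1)
    (hq : ∀ x ∈ E, ∀ y, PosStep p x y → q ≤ p x y) {y : X} (hy : y ∈ E) (hrec : IsRecurrent p y)
    (i n : ℕ) :
    P {ω | Reaches p y (ω n) ∧ ∀ j < i, ω (n + j) ≠ y} ≤ (1 - q ^ m) ^ (i / m) := by
  classical
  let D : Finset X := E.filter (Reaches p y)
  have hD : (D : Set X) = {z | Reaches p y z} := by
    refine Set.ext fun z => Finset.mem_filter.trans (and_iff_right_of_imp fun hyz => ?_)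
    exact hE.mem_of_reflTransGen hyz hy
  have hclosed : ClosedUnder (PosStep p) D := hD ▸ closedUnder_setOf_reaches p y
  refine hP.measure_mem_and_avoid_le (D := {z | Reaches p y z}) (T := {y}) (fun x hx => ?_) n
  exact avoidProb_le_one_sub_pow_pow (hclosed.liveStep _) ((Finset.card_filter_le _ _).trans hm) hq1
    (fun z hz => hq z (Finset.mem_filter.1 hz).1)
    (fun z hz => ⟨y, Set.mem_singleton y, hrec z (Finset.mem_filter.1 hz).2⟩) i
    (Finset.mem_coe.1 (hD ▸ hx))

theorem IsMarkovLaw.measure_not_isRecurrentClass_frequentStates_le (hP : IsMarkovLaw p P)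
    (hE : ClosedUnder (PosStep p) E) (hm : E.card ≤ m) (hq1 : q ≤ 1)
    (hq : ∀ x ∈ E, ∀ y, PosStep p x y → q ≤ p x y) (h0 : ∀ᵐ ω ∂P, ω 0 ∈ E) {i N : ℕ}
    (hN : (i + 2) * i ≤ N) :
    P {ω | ¬ IsRecurrentClass p (frequentStates ω i N)} ≤
      (1 + (i + 1) * m) * (1 - q ^ m) ^ (i / m) := by
  classical
  let I : Finset (ℕ × X) := Finset.range (i + 1) ×ˢ E.filter (IsRecurrent p)
  let transient : Set (ℕ → X) := {ω | ω 0 ∈ E ∧ ∀ j < i, ¬ IsRecurrent p (ω (0 + j))}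
  let missed (a : ℕ × X) : Set (ℕ → X) :=
    {ω | Reaches p a.2 (ω (i + a.1 * i)) ∧ ∀ j < i, ω (i + a.1 * i + j) ≠ a.2}
  have hcover : {ω | ¬ IsRecurrentClass p (frequentStates ω i N)} ≤ᵐ[P]
      (transient ∪ ⋃ a ∈ I, missed a : Set (ℕ → X)) := by
    filter_upwards [h0, hP.ae_posStep] with ω hωE hω hnot
    obtain htrans | ⟨b, hb, y, hrec, hy, hvisit⟩ := exists_missed_block hω hN hnot
    · exact .inl ⟨hωE, by simpa only [zero_add] using htrans⟩
    · have hyE : y ∈ E := hE.mem_of_reflTransGen hy hωE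
      exact .inr (Set.mem_iUnion₂.2 ⟨(b, y), Finset.mem_product.2
        ⟨Finset.mem_range.2 hb, Finset.mem_filter.2 ⟨hyE, hrec⟩⟩, hvisit⟩)
  have hmissed : ∀ a ∈ I, P (missed a) ≤ (1 - q ^ m) ^ (i / m) := by
    intro a ha
    obtain ⟨haE, hrec⟩ := Finset.mem_filter.1 (Finset.mem_product.1 ha).2
    exact hP.measure_reaches_and_ne_le hE hm hq1 hq haE hrec i _
  have hI : I.card ≤ (i + 1) * m := by
    rw [Finset.card_product, Finset.card_range]
    exact Nat.mul_le_mul_left _ ((Finset.card_filter_le _ _).trans hm)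
  calc P {ω | ¬ IsRecurrentClass p (frequentStates ω i N)}
      ≤ P (transient ∪ ⋃ a ∈ I, missed a) := measure_mono_ae hcover
    _ ≤ P transient + ∑ a ∈ I, P (missed a) :=
        (measure_union_le _ _).trans (by gcongr; exact measure_biUnion_finset_le _ _)
    _ ≤ (1 - q ^ m) ^ (i / m) + I.card • (1 - q ^ m) ^ (i / m) := by
        gcongr
        · exact hP.measure_not_isRecurrent_le hE hm hq1 hq i 0
        · exact Finset.sum_le_card_nsmul _ _ _ hmissed
    _ ≤ (1 + (i + 1) * m) * (1 - q ^ m) ^ (i / m) := by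
        rw [nsmul_eq_mul, add_mul, one_mul]
        gcongr
        exact_mod_cast hI

theorem IsMarkovLaw.exists_forall_mul_pow_le_measure_avoid (hP : IsMarkovLaw p P)
    (hE : ClosedUnder (PosStep p) E) (hm : E.card ≤ m + 1) (hq0 : q ≠ 0) (hq1 : q ≤ 1)
    (hq : ∀ x ∈ E, ∀ y, PosStep p x y → q ≤ p x y) {n : ℕ}
    (hn : ∀ x, P {ω | ω n = x} ≠ 0 → x ∈ E) (hT : P {ω | ∀ j, ω (n + j) ∉ T} ≠ 0) :
    ∃ x, P {ω | ω n = x} ≠ 0 ∧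
      ∀ k, P {ω | ω n = x} * q ^ m ≤ P {ω | ∀ j < k, ω (n + j) ∉ T} := by
  rw [← tsum_measure_inter_eval_eq _ n, Ne, ENNReal.tsum_eq_zero, not_forall] at hT
  obtain ⟨x, hx⟩ := hT
  have hx0 : P {ω | ω n = x} ≠ 0 := fun h => hx (measure_inter_null_of_null_right _ h)
  refine ⟨x, hx0, fun k => ?_⟩
  obtain hlim | hpow :=
    tendsto_avoidProb_or_forall_pow_le (hE.liveStep T) hm hq0 hq1 hq (hn x hx0)
  · refine absurd (le_zero_iff.1 (ge_of_tendsto' hlim fun k => ?_)) hx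
    calc P ({ω | ∀ j, ω (n + j) ∉ T} ∩ {ω | ω n = x})
        ≤ P {ω | ω n = x ∧ ∀ j < k, ω (n + j) ∉ T} :=
          measure_mono fun ω hω => ⟨hω.2, fun j _ => hω.1 j⟩
      _ ≤ avoidProb p T k x := by
          rw [hP.measure_eval_eq_and_avoid]
          exact mul_le_of_le_one_left' prob_le_one
  · calc P {ω | ω n = x} * q ^ m ≤ P {ω | ω n = x ∧ ∀ j < k, ω (n + j) ∉ T} := by
          rw [hP.measure_eval_eq_and_avoid]
          gcongr
          exact hpow k
      _ ≤ P {ω | ∀ j < k, ω (n + j) ∉ T} := measure_mono fun ω hω => hω.2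

end Recurrence

section Estimates

theorem one_sub_le_cond_real {Ω : Type*} [MeasurableSpace Ω] {P : Measure Ω}
    [IsProbabilityMeasure P] {N G : Set Ω} (hN : MeasurableSet N) {a b : ℝ} (ha : 0 < a)
    (haN : ENNReal.ofReal a ≤ P N) (hb : 0 ≤ b) (hG : P Gᶜ ≤ ENNReal.ofReal b) :
    1 - b * a⁻¹ ≤ (cond P N).real G := by
  have := cond_isProbabilityMeasure ((ENNReal.ofReal_pos.2 ha).trans_le haN).ne'
  have hcover : 1 ≤ (cond P N).real G + (cond P N).real Gᶜ := by
    simpa only [Set.union_compl_self, probReal_univ] using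
      measureReal_union_le (μ := cond P N) G Gᶜ
  have hcompl : (cond P N).real Gᶜ ≤ b * a⁻¹ := by
    refine ENNReal.toReal_le_of_le_ofReal (by positivity) ?_
    rw [cond_apply hN, mul_comm, ENNReal.ofReal_mul hb, ENNReal.ofReal_inv_of_pos ha]
    gcongr
    exact (measure_mono Set.inter_subset_right).trans hG
  linarith

variable {q κ : ℝ} {i m : ℕ}

theorem rpow_le_pow_of_natCast_le (hq0 : 0 < q) (hq1 : q ≤ 1) (hmκ : (m : ℝ) ≤ κ) :
    q ^ κ ≤ q ^ m := by
  rw [← Real.rpow_natCast]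
  exact Real.rpow_le_rpow_of_exponent_ge hq0 hq1 hmκ

theorem ofReal_rpow_le_pow (hq0 : 0 < q) (hq1 : q ≤ 1) (hmκ : (m : ℝ) ≤ κ) :
    ENNReal.ofReal (q ^ κ) ≤ ENNReal.ofReal q ^ m := by
  rw [← ENNReal.ofReal_pow hq0.le]
  exact ENNReal.ofReal_le_ofReal (rpow_le_pow_of_natCast_le hq0 hq1 hmκ)

theorem one_sub_pow_pow_div_le_exp (hq0 : 0 < q) (hq1 : q ≤ 1) (hm : 1 ≤ m) (hmκ : (m : ℝ) ≤ κ) :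
    (1 - q ^ m) ^ (i / m) ≤ 3 * Real.exp (-(q ^ κ / κ)) ^ i := by
  have hm1 : (1 : ℝ) ≤ m := by exact_mod_cast hm
  have hxm : q ^ κ ≤ q ^ m := rpow_le_pow_of_natCast_le hq0 hq1 hmκ
  have hbase : 0 ≤ 1 - q ^ m := sub_nonneg.2 (pow_le_one₀ hq0.le hq1)
  have hdiv : i / κ ≤ (i / m : ℕ) + 1 := by
    calc i / κ ≤ i / m := by gcongr
      _ ≤ (i / m : ℕ) + 1 := by
        rw [div_le_iff₀ (by linarith), mul_comm]
        exact_mod_cast (Nat.lt_mul_div_succ i (by omega)).le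
  calc (1 - q ^ m) ^ (i / m) ≤ Real.exp (-q ^ κ) ^ (i / m) := by
        gcongr
        linarith [Real.add_one_le_exp (-q ^ κ)]
    _ = Real.exp ((i / m : ℕ) * -q ^ κ) := (Real.exp_nat_mul _ _).symm
    _ ≤ Real.exp (1 + i * -(q ^ κ / κ)) := by
        refine Real.exp_le_exp.2 ?_
        have hx0 : 0 ≤ q ^ κ := Real.rpow_nonneg hq0.le _
        rw [mul_neg, mul_neg, mul_div_left_comm]
        linarith [mul_le_mul_of_nonneg_left hdiv hx0]
    _ = Real.exp 1 * Real.exp (-(q ^ κ / κ)) ^ i := by rw [Real.exp_add, Real.exp_nat_mul]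
    _ ≤ 3 * Real.exp (-(q ^ κ / κ)) ^ i := by
        gcongr
        exact Real.exp_one_lt_three.le

theorem mul_one_sub_pow_pow_div_le (hq0 : 0 < q) (hq1 : q ≤ 1) (hm : 1 ≤ m)
    (hmκ : (m : ℝ) + 1 ≤ κ) (hκi : κ ≤ i) :
    (1 + (i + 1) * m) * (1 - ENNReal.ofReal q ^ m) ^ (i / m) ≤
      ENNReal.ofReal (2 * Real.exp (-(q ^ κ / κ)) ^ i * (i : ℝ) ^ 3) := by
  have hm1 : (1 : ℝ) ≤ m := by exact_mod_cast hm
  have hbase : 0 ≤ 1 - q ^ m := sub_nonneg.2 (pow_le_one₀ hq0.le hq1)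
  have hcoe : (1 + (i + 1) * m : ℝ≥0∞) = ENNReal.ofReal (1 + (i + 1) * m) := by
    rw [← ENNReal.ofReal_natCast (n := m), ← ENNReal.ofReal_natCast (n := i)]
    rw [← ENNReal.ofReal_one, ← ENNReal.ofReal_add (by positivity) (by positivity),
      ← ENNReal.ofReal_mul (by positivity), ← ENNReal.ofReal_add (by positivity) (by positivity)]
  have hpow : (1 - ENNReal.ofReal q ^ m) ^ (i / m) = ENNReal.ofReal ((1 - q ^ m) ^ (i / m)) := by
    rw [ENNReal.ofReal_pow hbase, ENNReal.ofReal_sub _ (by positivity), ENNReal.ofReal_pow hq0.le,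
      ENNReal.ofReal_one]
  rw [hcoe, hpow, ← ENNReal.ofReal_mul (by positivity)]
  refine ENNReal.ofReal_le_ofReal ?_
  calc (1 + (i + 1) * m) * (1 - q ^ m) ^ (i / m)
      ≤ (i : ℝ) ^ 2 * (3 * Real.exp (-(q ^ κ / κ)) ^ i) := by
        gcongr
        · nlinarith
        · exact one_sub_pow_pow_div_le_exp hq0 hq1 hm (by linarith)
    _ ≤ (i : ℝ) ^ 2 * (2 * i * Real.exp (-(q ^ κ / κ)) ^ i) := by
        gcongr
        linarith
    _ = 2 * Real.exp (-(q ^ κ / κ)) ^ i * (i : ℝ) ^ 3 := by ring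

theorem add_two_mul_self_le_three_mul_pow (i : ℕ) : (i + 2) * i ≤ 3 * i ^ 3 := by
  have hsq : i ^ 2 ≤ i ^ 3 := by
    rw [pow_succ i 2]
    nlinarith [Nat.le_mul_self i]
  linarith [Nat.le_self_pow three_ne_zero i]

end Estimates

namespace MDP

variable {S A : Type*} {M : MDP S A} {U : S → A → ℝ} {Em pmin : ℝ}

section Transitions

theorem maxActions_subset_enabled (s : S) : M.maxActions U s ⊆ M.enabled s := by
  classical
  exact Finset.filter_subset _ _

theorem one_le_of_card_enabled_le (hEm : ∀ s, ((M.enabled s).card : ℝ) ≤ Em) : 1 ≤ Em :=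
  le_trans (by exact_mod_cast (M.enabled_nonempty M.init).card_pos) (hEm M.init)

theorem le_one_of_le_trans
    (hpmin_le : ∀ s, ∀ a ∈ M.enabled s, ∀ t ∈ (M.trans s a).support,
      pmin ≤ (M.trans s a t).toReal) : pmin ≤ 1 := by
  obtain ⟨a, ha⟩ := M.enabled_nonempty M.init
  obtain ⟨t, ht⟩ := (M.trans M.init a).support_nonempty
  exact (hpmin_le _ a ha t ht).trans
    (ENNReal.toReal_mono ENNReal.one_ne_top (PMF.coe_le_one _ t))

theorem div_mem_Ioc (hEm : ∀ s, ((M.enabled s).card : ℝ) ≤ Em) (hpmin : 0 < pmin)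
    (hpmin_le : ∀ s, ∀ a ∈ M.enabled s, ∀ t ∈ (M.trans s a).support,
      pmin ≤ (M.trans s a t).toReal) : pmin / Em ∈ Set.Ioc 0 1 := by
  have hEm1 := one_le_of_card_enabled_le hEm
  have hpmin1 := le_one_of_le_trans hpmin_le
  exact ⟨by positivity, div_le_one_of_le₀ (by linarith) (by linarith)⟩

open Classical in
theorem choose_apply (M : MDP S A) (U : S → A → ℝ) (s : S) (x : S × A) :
    M.choose U s x = if s = x.1 then M.greedy U x.1 x.2 else 0 := by
  obtain ⟨t, b⟩ := x
  rw [choose, PMF.map_apply]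
  by_cases hst : s = t
  · subst hst
    simp only [Prod.mk.injEq, true_and, tsum_ite_eq', if_true]
  · simp only [Prod.mk.injEq, Ne.symm hst, hst, false_and, if_false, tsum_zero]

theorem exploreStep_apply (M : MDP S A) (U : S → A → ℝ) (x y : S × A) :
    M.exploreStep U x y = M.trans x.1 x.2 y.1 * M.greedy U y.1 y.2 := by
  classical
  simp only [exploreStep, PMF.bind_apply, choose_apply, mul_ite, mul_zero, tsum_ite_eq]

theorem greedy_ne_zero_iff {s : S} {a : A} : M.greedy U s a ≠ 0 ↔ a ∈ M.maxActions U s := by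
  rw [greedy, ← PMF.mem_support_iff, PMF.mem_support_uniformOfFinset_iff]

theorem posStep_exploreStep_iff {x y : S × A} :
    PosStep (M.exploreStep U) x y ↔ M.trans x.1 x.2 y.1 ≠ 0 ∧ y.2 ∈ M.maxActions U y.1 := by
  rw [PosStep, exploreStep_apply, mul_ne_zero_iff, greedy_ne_zero_iff]

theorem inv_le_greedy (hEm : ∀ s, ((M.enabled s).card : ℝ) ≤ Em) {s : S} {a : A}
    (ha : a ∈ M.maxActions U s) : ENNReal.ofReal Em⁻¹ ≤ M.greedy U s a := by
  have hcard : ((M.maxActions U s).card : ℝ) ≤ Em :=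
    le_trans (by exact_mod_cast Finset.card_le_card (maxActions_subset_enabled s)) (hEm s)
  rw [greedy, PMF.uniformOfFinset_apply_of_mem _ ha,
    ENNReal.ofReal_inv_of_pos (one_pos.trans_le (one_le_of_card_enabled_le hEm)),
    ENNReal.inv_le_inv, ← ENNReal.ofReal_natCast]
  exact ENNReal.ofReal_le_ofReal hcard

theorem div_le_exploreStep (hEm : ∀ s, ((M.enabled s).card : ℝ) ≤ Em) (hpmin : 0 < pmin)
    (hpmin_le : ∀ s, ∀ a ∈ M.enabled s, ∀ t ∈ (M.trans s a).support,
      pmin ≤ (M.trans s a t).toReal)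
    {x y : S × A} (hx : x.2 ∈ M.enabled x.1) (hxy : PosStep (M.exploreStep U) x y) :
    ENNReal.ofReal (pmin / Em) ≤ M.exploreStep U x y := by
  obtain ⟨htrans, hy⟩ := posStep_exploreStep_iff.1 hxy
  rw [exploreStep_apply, div_eq_mul_inv, ENNReal.ofReal_mul hpmin.le]
  exact mul_le_mul' (ENNReal.ofReal_le_of_le_toReal
    (hpmin_le _ _ hx _ ((PMF.mem_support_iff _ _).2 htrans))) (inv_le_greedy hEm hy)

end Transitions

section EnabledPairs

variable [Fintype S]

/-- The state-action pairs `(s, a)` such that the action `a` is enabled in `s`. -/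
def enabledPairs (M : MDP S A) : Finset (S × A) :=
  (Finset.univ.sigma M.enabled).map (Equiv.sigmaEquivProd S A).toEmbedding

theorem mem_enabledPairs {x : S × A} : x ∈ M.enabledPairs ↔ x.2 ∈ M.enabled x.1 := by
  simp only [enabledPairs, Finset.mem_map_equiv, Finset.mem_sigma, Finset.mem_univ, true_and,
    Equiv.sigmaEquivProd_symm_apply]

theorem enabledPairs_nonempty (M : MDP S A) : M.enabledPairs.Nonempty := by
  obtain ⟨a, ha⟩ := M.enabled_nonempty M.init
  exact ⟨(M.init, a), mem_enabledPairs.2 ha⟩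

theorem card_enabledPairs_le (hEm : ∀ s, ((M.enabled s).card : ℝ) ≤ Em) :
    (M.enabledPairs.card : ℝ) ≤ Fintype.card S * Em := by
  rw [enabledPairs, Finset.card_map, Finset.card_sigma, Nat.cast_sum, ← Finset.card_univ,
    ← nsmul_eq_mul]
  exact Finset.sum_le_card_nsmul _ _ _ fun s _ => hEm s

theorem closedUnder_enabledPairs (M : MDP S A) (U : S → A → ℝ) :
    ClosedUnder (PosStep (M.exploreStep U)) M.enabledPairs :=
  fun _ _ _ hxy => Finset.mem_coe.2
    (mem_enabledPairs.2 (maxActions_subset_enabled _ (posStep_exploreStep_iff.1 hxy).2))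

end EnabledPairs

section EndComponent

theorem isEndComponent_of_isRecurrentClass {C : Set (S × A)}
    (hC : IsRecurrentClass (M.exploreStep U) C) :
    M.IsEndComponent (Prod.fst '' C) (Prod.snd '' C) := by
  have henabled {x : S × A} (hx : x ∈ C) : x.2 ∈ M.enabled x.1 := by
    obtain ⟨w, -, hwx⟩ := hC.exists_posStep hx
    exact maxActions_subset_enabled _ (posStep_exploreStep_iff.1 hwx).2
  refine ⟨hC.nonempty.image _, ?_, ?_, ?_⟩
  · rintro _ ⟨x, hx, rfl⟩
    exact ⟨x.1, Set.mem_image_of_mem _ hx, henabled hx⟩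
  · rintro s - _ ⟨x, hx, rfl⟩ hxs t ht
    obtain rfl : x.1 = s := by
      by_contra hne
      exact Finset.disjoint_left.1 (M.enabled_disjoint _ _ hne) (henabled hx) hxs
    obtain ⟨b, hb⟩ := M.maxActions_nonempty U t
    exact ⟨(t, b), hC.closed x hx _ (posStep_exploreStep_iff.2 ⟨ht.ne', hb⟩), rfl⟩
  · rintro _ ⟨x, hx, rfl⟩ _ ⟨y, hy, rfl⟩
    have hxy := hC.connected x hx y hy
    clear hy
    induction hxy with
    | refl => exact .refl
    | @tail u v hxu huv ih =>
      have huC : u ∈ C := hC.closed.mem_of_reflTransGen hxu hx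
      exact ih.tail ⟨u.2, Set.mem_image_of_mem _ huC, henabled huC,
        pos_iff_ne_zero.2 (posStep_exploreStep_iff.1 huv).1⟩

theorem lt_occurrences_iff (ω : ℕ → S × A) (i n : ℕ) (x : S × A) :
    i < occurrences ω n x ↔ x ∈ frequentStates ω i n := by
  rw [occurrences, frequentStates, Set.mem_ofPred_eq, Nat.count_eq_card_filter_range]
  congr!

theorem appStates_eq_image (ω : ℕ → S × A) (n i : ℕ) :
    appStates ω n i = Prod.fst '' frequentStates ω i n := by
  ext s
  simp only [appStates, lt_occurrences_iff, Set.mem_ofPred_eq, Set.mem_image, Prod.exists,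
    exists_and_right, exists_eq_right]

theorem appActions_eq_image (ω : ℕ → S × A) (n i : ℕ) :
    appActions ω n i = Prod.snd '' frequentStates ω i n := by
  ext a
  simp only [appActions, lt_occurrences_iff, Set.mem_ofPred_eq, Set.mem_image, Prod.exists,
    exists_eq_right]

end EndComponent

section Explore

theorem compl_terminatesWithin (zero one : S) (n : ℕ) :
    (terminatesWithin (A := A) zero one n)ᶜ =
      {ω | ∀ j < n, ω (1 + j) ∉ Prod.fst ⁻¹' {zero, one}} := by
  ext ω
  simp only [terminatesWithin, Set.mem_compl_iff, Set.mem_ofPred_eq, not_exists, not_and,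
    Set.mem_preimage, Set.mem_insert_iff, Set.mem_singleton_iff]
  refine ⟨fun h j hj => h (1 + j) (by omega) (by omega), fun h k hk hkn => ?_⟩
  obtain ⟨j, rfl⟩ := Nat.exists_eq_add_of_le hk
  exact h j (by omega)

theorem compl_terminates (zero one : S) :
    (terminates (A := A) zero one)ᶜ = {ω | ∀ j, ω (1 + j) ∉ Prod.fst ⁻¹' {zero, one}} := by
  ext ω
  simp only [terminates, Set.mem_compl_iff, Set.mem_ofPred_eq, not_exists, not_and,
    Set.mem_preimage, Set.mem_insert_iff, Set.mem_singleton_iff]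
  refine ⟨fun h j => h (1 + j) (by omega), fun h k hk => ?_⟩
  obtain ⟨j, rfl⟩ := Nat.exists_eq_add_of_le hk
  exact h j

theorem dependsOn_compl_terminatesWithin (zero one : S) (n : ℕ) :
    DependsOn (· ∈ (terminatesWithin (A := A) zero one n)ᶜ) (Set.Iic n) := by
  intro ω ω' h
  simp only [compl_terminatesWithin, Set.mem_ofPred_eq, eq_iff_iff]
  exact forall₂_congr fun j hj => by rw [h (1 + j) (by simp only [Set.mem_Iic]; omega)]

variable [MeasurableSpace S] [MeasurableSpace A] [DiscreteMeasurableSpace S]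
  [DiscreteMeasurableSpace A] [Countable A]

section Countable

variable [Countable S]

instance instIsProbabilityMeasureExploreMeasure (M : MDP S A) (U : S → A → ℝ) :
    IsProbabilityMeasure (M.exploreMeasure U) := by
  have := PMF.toMeasure.isProbabilityMeasure (M.choose U M.init)
  exact inferInstanceAs (IsProbabilityMeasure
    (Kernel.trajMeasure (X := fun _ => S × A) (M.choose U M.init).toMeasure (M.exploreKernel U)))

theorem isMarkovLaw_exploreMeasure (M : MDP S A) (U : S → A → ℝ) :
    IsMarkovLaw (M.exploreStep U) (M.exploreMeasure U) := by
  have := PMF.toMeasure.isProbabilityMeasure (M.choose U M.init)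
  exact isMarkovLaw_trajMeasure (μ₀ := (M.choose U M.init).toMeasure) (κ := M.exploreKernel U)
    fun n h => Kernel.comap_apply _ _ _

theorem exploreMeasure_eval_zero_eq (M : MDP S A) (U : S → A → ℝ) (x : S × A) :
    M.exploreMeasure U {ω | ω 0 = x} = M.choose U M.init x := by
  have hpreimage : {ω : ℕ → S × A | ω 0 = x} = Preorder.frestrictLe (π := fun _ => S × A) 0 ⁻¹'
      {h | h ⟨0, Finset.mem_Iic.2 le_rfl⟩ = x} := rfl
  rw [hpreimage, ← Measure.map_apply (by fun_prop) .of_discrete, exploreMeasure,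
    Measure.map_comp _ _ (by fun_prop), Kernel.traj_map_frestrictLe, Kernel.partialTraj_self,
    Measure.id_comp, Measure.map_apply Measurable.of_discrete .of_discrete,
    ← PMF.toMeasure_apply_singleton _ _ .of_discrete]
  rfl

end Countable

variable [Fintype S]

theorem mem_enabledPairs_and_div_le_exploreMeasure_eval_zero_eq
    (hEm : ∀ s, ((M.enabled s).card : ℝ) ≤ Em) (hpmin1 : pmin ≤ 1) {x : S × A}
    (hx : M.exploreMeasure U {ω | ω 0 = x} ≠ 0) :
    x ∈ M.enabledPairs ∧ ENNReal.ofReal (pmin / Em) ≤ M.exploreMeasure U {ω | ω 0 = x} := by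
  classical
  rw [exploreMeasure_eval_zero_eq, choose_apply] at hx ⊢
  obtain ⟨hinit, hgreedy⟩ := ite_ne_right_iff.1 hx
  have hmax : x.2 ∈ M.maxActions U x.1 := greedy_ne_zero_iff.1 hgreedy
  rw [if_pos hinit]
  refine ⟨mem_enabledPairs.2 (maxActions_subset_enabled _ hmax),
    (ENNReal.ofReal_le_ofReal ?_).trans (inv_le_greedy hEm hmax)⟩
  rw [div_eq_mul_inv]
  exact mul_le_of_le_one_left
    (inv_nonneg.2 (zero_le_one.trans (one_le_of_card_enabled_le hEm))) hpmin1

theorem ae_eval_zero_mem_enabledPairs (M : MDP S A) (U : S → A → ℝ) :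
    ∀ᵐ ω ∂M.exploreMeasure U, ω 0 ∈ M.enabledPairs := by
  filter_upwards [ae_measure_eval_eq_ne_zero (M.exploreMeasure U)] with ω hω
  exact (mem_enabledPairs_and_div_le_exploreMeasure_eval_zero_eq (pmin := 1)
    (Em := ∑ s, ((M.enabled s).card : ℝ)) (fun s => Finset.single_le_sum
      (f := fun s => ((M.enabled s).card : ℝ)) (fun _ _ => Nat.cast_nonneg _) (Finset.mem_univ s))
    le_rfl (hω 0)).1

theorem pow_le_exploreMeasure_compl_terminatesWithin
    (hEm : ∀ s, ((M.enabled s).card : ℝ) ≤ Em) (hpmin : 0 < pmin)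
    (hpmin_le : ∀ s, ∀ a ∈ M.enabled s, ∀ t ∈ (M.trans s a).support,
      pmin ≤ (M.trans s a t).toReal)
    {zero one : S} (hterm : M.exploreMeasure U (terminates zero one) < 1) (n : ℕ) :
    ENNReal.ofReal (pmin / Em) ^ (M.enabledPairs.card + 1) ≤
      M.exploreMeasure U (terminatesWithin zero one n)ᶜ := by
  obtain ⟨m, hm⟩ := Nat.exists_eq_add_of_le' M.enabledPairs_nonempty.card_pos
  obtain ⟨hq0, hq1⟩ := div_mem_Ioc hEm hpmin hpmin_le
  have hq : ∀ x ∈ M.enabledPairs, ∀ y, PosStep (M.exploreStep U) x y →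
      ENNReal.ofReal (pmin / Em) ≤ M.exploreStep U x y :=
    fun x hx _ => div_le_exploreStep hEm hpmin hpmin_le (mem_enabledPairs.1 hx)
  have hnot : M.exploreMeasure U (terminates zero one)ᶜ ≠ 0 := fun hnull =>
    hterm.ne ((measure_of_measure_compl_eq_zero hnull).trans measure_univ)
  have hlaw (x : S × A) := (M.isMarkovLaw_exploreMeasure U).pow_le_measure_eval_eq
    (closedUnder_enabledPairs M U) hq
    (fun _ => mem_enabledPairs_and_div_le_exploreMeasure_eval_zero_eq hEm
      (le_one_of_le_trans hpmin_le)) 1 (x := x)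
  rw [compl_terminates] at hnot
  obtain ⟨x, hx, hxn⟩ := (M.isMarkovLaw_exploreMeasure U).exists_forall_mul_pow_le_measure_avoid
    (closedUnder_enabledPairs M U) hm.le (ENNReal.ofReal_pos.2 hq0).ne'
    (ENNReal.ofReal_le_one.2 hq1) hq (fun x hx => (hlaw x hx).1) hnot
  calc ENNReal.ofReal (pmin / Em) ^ (M.enabledPairs.card + 1)
      = ENNReal.ofReal (pmin / Em) ^ (1 + 1) * ENNReal.ofReal (pmin / Em) ^ m := by
        rw [hm, ← pow_add, add_assoc, add_comm]
    _ ≤ M.exploreMeasure U {ω | ω 1 = x} * ENNReal.ofReal (pmin / Em) ^ m := by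
        gcongr
        exact (hlaw x hx).2
    _ ≤ M.exploreMeasure U (terminatesWithin zero one n)ᶜ :=
        (hxn n).trans_eq (congrArg _ (compl_terminatesWithin zero one n).symm)

theorem exploreMeasure_not_isEndComponent_le
    (hEm : ∀ s, ((M.enabled s).card : ℝ) ≤ Em) (hpmin : 0 < pmin)
    (hpmin_le : ∀ s, ∀ a ∈ M.enabled s, ∀ t ∈ (M.trans s a).support,
      pmin ≤ (M.trans s a t).toReal)
    {i N : ℕ} (hN : (i + 2) * i ≤ N) :
    M.exploreMeasure U {ω | M.IsEndComponent (appStates ω N i) (appActions ω N i)}ᶜ ≤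
      (1 + (i + 1) * M.enabledPairs.card) *
        (1 - ENNReal.ofReal (pmin / Em) ^ M.enabledPairs.card) ^ (i / M.enabledPairs.card) := by
  have hsub : {ω | M.IsEndComponent (appStates ω N i) (appActions ω N i)}ᶜ ⊆
      {ω | ¬ IsRecurrentClass (M.exploreStep U) (frequentStates ω i N)} := by
    intro ω hω hclass
    rw [Set.mem_compl_iff, Set.mem_ofPred_eq, appStates_eq_image, appActions_eq_image] at hω
    exact hω (isEndComponent_of_isRecurrentClass hclass)
  exact (measure_mono hsub).trans
    ((M.isMarkovLaw_exploreMeasure U).measure_not_isRecurrentClass_frequentStates_le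
      (closedUnder_enabledPairs M U) le_rfl
      (ENNReal.ofReal_le_one.2 (div_mem_Ioc hEm hpmin hpmin_le).2)
      (fun x hx _ => div_le_exploreStep hEm hpmin hpmin_le (mem_enabledPairs.1 hx))
      (ae_eval_zero_mem_enabledPairs M U) hN)

end Explore

end MDP

open MDP in
theorem mainTheorem5_general {S A : Type*} [Fintype S] [Countable A]
    [MeasurableSpace S] [DiscreteMeasurableSpace S]
    [MeasurableSpace A] [DiscreteMeasurableSpace A]
    (M : MDP S A) (zero one : S) (U : S → A → ℝ)
    (K Em pmin : ℝ) (hK : (Fintype.card S : ℝ) ≤ K)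
    (hEm : ∀ s, ((M.enabled s).card : ℝ) ≤ Em)
    (hpmin : 0 < pmin)
    (hpmin_le : ∀ s, ∀ a ∈ M.enabled s, ∀ t ∈ (M.trans s a).support,
      pmin ≤ (M.trans s a t).toReal)
    (κ c : ℝ) (hκ : κ = K * Em + 1) (hc : c = Real.exp (-((pmin / Em) ^ κ / κ)))
    (i : ℕ) (hi : κ ≤ (i : ℝ))
    (hterm : M.exploreMeasure U (terminates zero one) < 1) :
    M.exploreMeasure U (terminatesWithin zero one (3 * i ^ 3))ᶜ ≠ 0 ∧
      1 - 2 * c ^ i * (i : ℝ) ^ 3 * (pmin / Em) ^ (-κ) ≤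
        (cond (M.exploreMeasure U) (terminatesWithin zero one (3 * i ^ 3))ᶜ).real
          {ω | M.IsEndComponent (appStates ω (3 * i ^ 3) i) (appActions ω (3 * i ^ 3) i)} := by
  obtain ⟨hq0, hq1⟩ := div_mem_Ioc hEm hpmin hpmin_le
  have hm : 1 ≤ M.enabledPairs.card := M.enabledPairs_nonempty.card_pos
  have hmκ : (M.enabledPairs.card : ℝ) + 1 ≤ κ := by
    nlinarith [card_enabledPairs_le hEm, one_le_of_card_enabled_le hEm]
  have hnonterm : ENNReal.ofReal ((pmin / Em) ^ κ) ≤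
      M.exploreMeasure U (terminatesWithin zero one (3 * i ^ 3))ᶜ :=
    (ofReal_rpow_le_pow hq0 hq1 (by exact_mod_cast hmκ)).trans
      (pow_le_exploreMeasure_compl_terminatesWithin hEm hpmin hpmin_le hterm _)
  have hnotEC := (exploreMeasure_not_isEndComponent_le (U := U) hEm hpmin hpmin_le
    (add_two_mul_self_le_three_mul_pow i)).trans (mul_one_sub_pow_pow_div_le hq0 hq1 hm hmκ hi)
  have hmeas := measurableSet_of_dependsOn_Iic (X := S × A)
    (dependsOn_compl_terminatesWithin zero one (3 * i ^ 3))
  have hqκ : 0 < (pmin / Em) ^ κ := Real.rpow_pos_of_pos hq0 κ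
  refine ⟨((ENNReal.ofReal_pos.2 hqκ).trans_le hnonterm).ne', ?_⟩
  rw [hc, Real.rpow_neg hq0.le]
  exact one_sub_le_cond_real hmeas hqκ hnonterm (by positivity) hnotEC

theorem mainTheorem5 {S A : Type*} [Fintype S] [Fintype A]
    [MeasurableSpace S] [DiscreteMeasurableSpace S]
    [MeasurableSpace A] [DiscreteMeasurableSpace A]
    (M : MDP S A) (zero one : S) (hzero : M.IsTerminal zero) (hone : M.IsTerminal one)
    (U : S → A → ℝ)
    (K Em pmin : ℝ) (hK : (Fintype.card S : ℝ) ≤ K)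
    (hEm : ∀ s, ((M.enabled s).card : ℝ) ≤ Em)
    (hpmin : 0 < pmin)
    (hpmin_le : ∀ s, ∀ a ∈ M.enabled s, ∀ t ∈ (M.trans s a).support,
      pmin ≤ (M.trans s a t).toReal)
    (κ c : ℝ) (hκ : κ = K * Em + 1) (hc : c = Real.exp (-((pmin / Em) ^ κ / κ)))
    (i : ℕ) (hi : κ ≤ (i : ℝ))
    (hterm : M.exploreMeasure U (terminates zero one) < 1) :
    M.exploreMeasure U (terminatesWithin zero one (3 * i ^ 3))ᶜ ≠ 0 ∧
      1 - 2 * c ^ i * (i : ℝ) ^ 3 * (pmin / Em) ^ (-κ) ≤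
        (cond (M.exploreMeasure U) (terminatesWithin zero one (3 * i ^ 3))ᶜ).real
          {ω | M.IsEndComponent (appStates ω (3 * i ^ 3) i) (appActions ω (3 * i ^ 3) i)} :=
  mainTheorem5_general M zero one U K Em pmin hK hEm hpmin hpmin_le κ c hκ hc i hi hterm
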